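/- Fix a language consisting of operation symbols of finite arities (constants allowed). Algebras are nonempty, and classes of algebras are closed under isomorphism. A quasi-identity is a sentence $q=(\forall \bar x)\,[\varphi(\bar x)\to\psi(\bar x)]$, where $\varphi$ is a finite, possibly empty, conjunction of equations between terms and $\psi$ is one such equation; put $q^*=(\forall\bar x)\,[\neg\varphi(\bar x)]$. A quasivariety is a class of algebras defined by a set of quasi-identities. For an algebra $\mathbf B$, let $\mathsf Q(\mathbf B)$ denote the quasivariety generated by $\mathbf B$, i.e. the class of all algebras satisfying every quasi-identity true in $\mathbf B$. Let $\mathcal Q$ be a quasivariety. For a set $X$ of variables such that there is at least one term over $X$, let $\mathbf F_{\mathcal Q}(X)$ be the free algebra for $\mathcal Q$ over $X$, that is, the algebra of terms over $X$ divided by the congruence identifying $s$ and $t$ whenever $\mathcal Q\models(\forall\bar x)\,[s(\bar x)= t(\bar x)]$. Let $\mathbf F=\mathbf F_{\mathcal Q}(\{v_0,v_1,v_2,\dots\})$ and $\mathbf F(k)=\mathbf F_{\mathcal Q}(\{v_0,\dots,v_{k-1}\})$ (so $\mathbf F(0)$ exists only if the language has a constant). A $\mathcal Q$-congruence of an algebra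 $\mathbf A$ is a congruence $\theta$ with $\mathbf A/\theta\in\mathcal Q$; for $H\subseteq A^2$ let $\theta_{\mathcal Q}(H)$ be the least $\mathcal Q$-congruence of $\mathbf A$ containing $H$. An algebra is $\mathcal Q$-finitely presented if it is isomorphic to $\mathbf F(k)/\theta_{\mathcal Q}(H)$ for some natural number $k$ for which $\mathbf F(k)$ exists and some finite $H\subseteq F(k)^2$. An algebra $\mathbf S\in\mathcal Q$ with more than one element is $\mathcal Q$-subdirectly irreducible if the equality relation on $S$ is completely meet irreducible in the lattice of $\mathcal Q$-congruences of $\mathbf S$, i.e. it belongs to every set of $\mathcal Q$-congruences whose meet it is. Finally, $\mathcal Q$ is almost structurally complete if every quasi-identity $q$ such that $\mathbf F\models q$ and $\mathbf F\not\models q^*$ holds in all members of $\mathcal Q$. **Theorem 3.1.** For every quasivariety $\mathcal Q$ the following conditions are equivalent: 1. $\mathcal Q$ is almost structurally complete; 2. $\mathbf A\times\mathbf F\in\mathsf Q(\mathbf F)$ for every $\mathbf A\in\mathcal Q$; 3. $\mathbf S\times\mathbf F\in\mathsf Q(\mathbf F)$ for every $\mathcal Q$-subdirectly irreducible algebra $\mathbf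 S$; 4. every $\mathbf A\in\mathcal Q$ that admits a homomorphism into $\mathbf F$ belongs to $\mathsf Q(\mathbf F)$; 5. every $\mathcal Q$-finitely presented algebra that admits a homomorphism into $\mathbf F$ belongs to $\mathsf Q(\mathbf F)$. -/

import Mathlib

open scoped FirstOrder

universe u v w x

namespace QuasiVar

open FirstOrder.Language

/-- An algebra in the language `L` (used for languages without relation symbols): a nonempty
carrier together with an interpretation of the operation symbols. The carriers range over a
universe large enough to contain the terms of `L`. -/
structure Alg (L : FirstOrder.Language.{u, v}) where
  carrier : Type (max u w)
  [str : L.Structure carrier]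
  [nonempty : Nonempty carrier]

attribute [instance] Alg.str Alg.nonempty

instance (L : FirstOrder.Language.{u, v}) : CoeSort (Alg.{u, v, w} L) (Type (max u w)) := ⟨Alg.carrier⟩

/-- The quasi-identity `∀ x₀ … x_{k-1}, (s₁ = t₁ ∧ ⋯ ∧ s_n = t_n → s = t)`; an equation is a pair
of terms. The list of premises may be empty. -/
structure QuasiIdentity (L : FirstOrder.Language.{u, v}) where
  numVars : ℕ
  premise : List (L.Term (Fin numVars) × L.Term (Fin numVars))
  conclusion : L.Term (Fin numVars) × L.Term (Fin numVars)

variable {L : FirstOrder.Language.{u, v}}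

/-- The equation `e` holds in `A` under the assignment `a`. -/
def EqHolds (A : Alg.{u, v, w} L) {X : Type x} (a : X → A) (e : L.Term X × L.Term X) : Prop :=
  e.1.realize a = e.2.realize a

/-- `A ⊨ q`. -/
def Satisfies (A : Alg.{u, v, w} L) (q : QuasiIdentity L) : Prop :=
  ∀ a : Fin q.numVars → A, (∀ e ∈ q.premise, EqHolds A a e) → EqHolds A a q.conclusion

/-- `A ⊨ q*`, where `q* = ∀ x̄, ¬ φ(x̄)` for `q = ∀ x̄, (φ(x̄) → ψ(x̄))`. -/
def SatisfiesStar (A : Alg.{u, v, w} L) (q : QuasiIdentity L) : Prop :=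
  ∀ a : Fin q.numVars → A, ¬ ∀ e ∈ q.premise, EqHolds A a e

/-- A quasivariety is a class of algebras that is defined by some set of quasi-identities. -/
def IsQuasivariety (Q : Set (Alg.{u, v, w} L)) : Prop :=
  ∃ T : Set (QuasiIdentity L), Q = {A | ∀ q ∈ T, Satisfies A q}

/-- The quasivariety generated by an algebra: the class defined by all quasi-identities that are
true in it. -/
def generatedBy (B : Alg.{u, v, w} L) : Set (Alg.{u, v, w} L) :=
  {A | ∀ q : QuasiIdentity L, Satisfies B q → Satisfies A q}

/-- The direct product `A × B`. -/
def Alg.prod (A B : Alg.{u, v, w} L) : Alg.{u, v, w} L where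
  carrier := A × B
  str :=
    { funMap := fun f z => (Structure.funMap f fun i => (z i).1, Structure.funMap f fun i => (z i).2)
      RelMap := fun r z => (Structure.RelMap r fun i => (z i).1) ∧
        Structure.RelMap r fun i => (z i).2 }

/-- Congruences of an algebra: equivalence relations compatible with the basic operations. -/
structure Congruence (A : Alg.{u, v, w} L) extends Setoid A where
  compat : ∀ {n : ℕ} (f : L.Functions n) (y z : Fin n → A),
    (∀ i, r (y i) (z i)) → r (Structure.funMap f y) (Structure.funMap f z)

/-- The equality relation on `A`. -/
def Congruence.eq (A : Alg.{u, v, w} L) : Congruence A where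
  r a b := a = b
  iseqv := eq_equivalence
  compat f y z h := by rw [funext h]

/-- The intersection of a set of congruences (the total relation, if the set is empty). -/
def Congruence.inter {A : Alg.{u, v, w} L} (C : Set (Congruence A)) : Congruence A where
  r a b := ∀ θ ∈ C, θ.r a b
  iseqv := ⟨fun a θ _ => θ.iseqv.refl a, fun h θ hθ => θ.iseqv.symm (h θ hθ),
    fun h h' θ hθ => θ.iseqv.trans (h θ hθ) (h' θ hθ)⟩
  compat f y z h θ hθ := θ.compat f y z fun i => h i θ hθ

section

variable [L.IsAlgebraic]

/-- A congruence is what is needed to form a quotient structure. -/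
@[reducible] def Congruence.prestructure {A : Alg.{u, v, w} L} (θ : Congruence A) :
    L.Prestructure θ.toSetoid where
  toStructure := A.str
  fun_equiv y z h := θ.compat _ y z h
  rel_equiv {_} r := isEmptyElim r

/-- The quotient algebra `A / θ`. -/
def Alg.quot (A : Alg.{u, v, w} L) (θ : Congruence A) : Alg.{u, v, w} L where
  carrier := Quotient θ.toSetoid
  str := @quotientStructure L A θ.toSetoid θ.prestructure
  nonempty := A.nonempty.map (Quotient.mk θ.toSetoid)

/-- The set of `Q`-congruences of `A`: those congruences `θ` for which `A / θ` belongs to `Q`. -/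
def conQ (Q : Set (Alg.{u, v, w} L)) (A : Alg.{u, v, w} L) : Set (Congruence A) :=
  {θ | A.quot θ ∈ Q}

/-- `S` is `Q`-subdirectly irreducible: a nontrivial member of `Q` whose equality relation is
completely meet irreducible among the `Q`-congruences, i.e. it is not the meet of any set of
`Q`-congruences to which it does not belong. (For a quasivariety `Q`, arbitrary meets of
`Q`-congruences are intersections.) -/
def IsSubdirectlyIrreducible (Q : Set (Alg.{u, v, w} L)) (S : Alg.{u, v, w} L) : Prop :=
  S ∈ Q ∧ Nontrivial S ∧
    ∀ C ⊆ conQ Q S, Congruence.inter C = Congruence.eq S → Congruence.eq S ∈ C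

/-- The least `Q`-congruence containing `H`, obtained (for a quasivariety `Q`) as the intersection
of all `Q`-congruences containing `H`. -/
def leastCon (Q : Set (Alg.{u, v, w} L)) (A : Alg.{u, v, w} L) (H : Set (A × A)) : Congruence A :=
  Congruence.inter {θ | θ ∈ conQ Q A ∧ ∀ p ∈ H, θ.r p.1 p.2}

/-- The algebra of terms over the variables `X`. It exists only if there is a term at all, i.e.
if there is a variable or a constant symbol. -/
def termAlg (L : FirstOrder.Language.{u, v}) [L.IsAlgebraic] (X : Type w) [Nonempty (L.Term X)] :
    Alg.{u, v, w} L where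
  carrier := L.Term X
  str := { funMap := fun f ts => Term.func f ts, RelMap := fun r => isEmptyElim r }

/-- The congruence that identifies two terms if they take the same values in all members of `Q`,
i.e. if `Q ⊨ ∀ x̄, s(x̄) = t(x̄)`. -/
def freeCon (Q : Set (Alg.{u, v, w} L)) (X : Type w) [Nonempty (L.Term X)] :
    Congruence (termAlg L X) where
  r s t := ∀ A ∈ Q, ∀ a : X → A, Term.realize (L := L) a s = Term.realize (L := L) a t
  iseqv := ⟨fun _ _ _ _ => rfl, fun h A hA a => (h A hA a).symm,
    fun h h' A hA a => (h A hA a).trans (h' A hA a)⟩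
  compat f _ _ h A hA a := congrArg (Structure.funMap f) (funext fun i => h i A hA a)

/-- The free algebra for `Q` over the set of variables `X`. -/
abbrev freeAlg (Q : Set (Alg.{u, v, w} L)) (X : Type w) [Nonempty (L.Term X)] : Alg.{u, v, w} L :=
  (termAlg L X).quot (freeCon Q X)

/-- The free algebra `F` for `Q` over countably infinitely many variables. -/
abbrev freeOmega (Q : Set (Alg.{u, v, w} L)) : Alg.{u, v, w} L :=
  freeAlg Q (ULift.{w} ℕ)

/-- `P` is `Q`-finitely presented: isomorphic to `F(k) / θ_Q(H)` for some `k` for which the free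
algebra `F(k)` for `Q` over `k` variables exists, and some finite `H`. -/
def IsFinitelyPresented (Q : Set (Alg.{u, v, w} L)) (P : Alg.{u, v, w} L) : Prop :=
  ∃ (k : ℕ) (_ : Nonempty (L.Term (ULift.{w} (Fin k))))
    (H : Set (freeAlg Q (ULift.{w} (Fin k)) × freeAlg Q (ULift.{w} (Fin k)))),
    H.Finite ∧
      Nonempty (P ≃[L] (freeAlg Q (ULift.{w} (Fin k))).quot
        (leastCon Q (freeAlg Q (ULift.{w} (Fin k))) H))

/-- A quasi-identity is `Q`-active if it is true in `F` and `q*` is not true in `F`. -/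
def IsActive (Q : Set (Alg.{u, v, w} L)) (q : QuasiIdentity L) : Prop :=
  Satisfies (freeOmega Q) q ∧ ¬ SatisfiesStar (freeOmega Q) q

/-- `Q` is almost structurally complete: every `Q`-active quasi-identity holds in `Q`. -/
def IsASC (Q : Set (Alg.{u, v, w} L)) : Prop :=
  ∀ q : QuasiIdentity L, IsActive Q q → ∀ A ∈ Q, Satisfies A q

end

end QuasiVar

/-! Quasi-identities pass to subalgebras and products, while homomorphisms carry solutions of the
premises forward. Hence a `q` true in `F` is either active, or its premises have no solution in `F`
and so none in `A × F`, which projects onto `F`. This gives (1) → (2).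

If `A` maps to `F`, the graph of the map embeds `A` into `A × F`, so (2) → (4). For (5) → (1), let
`P` be presented by the premises of an active `q`. A solution in `F` is a homomorphism `P → F`, so
`P` satisfies `q`, and its conclusion, true at the generators, is carried to any solution in any
member of `Q`.

For (3) → (2), `IsQuasivariety.exists_isSubdirectlyIrreducible` separates two unequal elements of
`A` in a subdirectly irreducible quotient. It rests on Zorn's lemma, where unions of chains of
`Q`-congruences are `Q`-congruences because premises are finite. -/

namespace QuasiVar

open FirstOrder.Language

/-! ### Preservation of quasi-identities -/

section Preservation

variable {L : FirstOrder.Language.{u, v}} {A B : Alg.{u, v, w} L}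

theorem EqHolds.map {X : Type x} {a : X → A} {e : L.Term X × L.Term X} (h : EqHolds A a e)
    (f : A →[L] B) : EqHolds B (f ∘ a) e := by
  unfold EqHolds at *
  rw [HomClass.realize_term, HomClass.realize_term, h]

theorem EqHolds.of_map {X : Type x} {a : X → A} {e : L.Term X × L.Term X} {f : A →[L] B}
    (hf : Function.Injective f) (h : EqHolds B (f ∘ a) e) : EqHolds A a e := by
  unfold EqHolds at *
  rw [HomClass.realize_term, HomClass.realize_term] at h
  exact hf h

theorem Satisfies.of_injective {q : QuasiIdentity L} {f : A →[L] B}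
    (hf : Function.Injective f) (hB : Satisfies B q) : Satisfies A q := fun a ha =>
  EqHolds.of_map hf (hB (f ∘ a) fun e he => (ha e he).map f)

theorem SatisfiesStar.of_hom {q : QuasiIdentity L} (f : A →[L] B) (hB : SatisfiesStar B q) :
    SatisfiesStar A q := fun a ha => hB (f ∘ a) fun e he => (ha e he).map f

theorem SatisfiesStar.satisfies {q : QuasiIdentity L} (h : SatisfiesStar A q) : Satisfies A q :=
  fun a ha => (h a ha).elim

theorem IsQuasivariety.mem_of_injective {Q : Set (Alg.{u, v, w} L)} (hQ : IsQuasivariety Q)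
    {f : A →[L] B} (hf : Function.Injective f) (hB : B ∈ Q) : A ∈ Q := by
  obtain ⟨T, rfl⟩ := hQ
  exact fun q hq => (hB q hq).of_injective hf

variable [L.IsAlgebraic]

/-- Over an algebraic language, maps that respect the operations are homomorphisms. -/
def homOfMapFun (f : A → B)
    (hf : ∀ {n : ℕ} (g : L.Functions n) (x : Fin n → A),
      f (Structure.funMap g x) = Structure.funMap g (f ∘ x)) : A →[L] B where
  toFun := f
  map_fun' := hf
  map_rel' {_} r := isEmptyElim r

/-- The first projection of a product. -/
def prodFst (A B : Alg.{u, v, w} L) : A.prod B →[L] A :=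
  homOfMapFun (A := A.prod B) Prod.fst fun _ _ => rfl

/-- The second projection of a product. -/
def prodSnd (A B : Alg.{u, v, w} L) : A.prod B →[L] B :=
  homOfMapFun (A := A.prod B) Prod.snd fun _ _ => rfl

/-- The graph of a homomorphism, as an embedding into the product. -/
def prodGraph (f : A →[L] B) : A →[L] A.prod B :=
  homOfMapFun (B := A.prod B) (fun a => (a, f a)) fun g x =>
    Prod.ext rfl (HomClass.map_fun f g x)

theorem prodGraph_injective (f : A →[L] B) : Function.Injective (prodGraph f) :=
  fun _ _ h => congrArg Prod.fst h

theorem EqHolds.prod {X : Type x} {a : X → A.prod B} {e : L.Term X × L.Term X}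
    (h₁ : EqHolds A (prodFst A B ∘ a) e) (h₂ : EqHolds B (prodSnd A B ∘ a) e) :
    EqHolds (A.prod B) a e := by
  unfold EqHolds at *
  rw [HomClass.realize_term, HomClass.realize_term] at h₁ h₂
  exact Prod.ext h₁ h₂

theorem Satisfies.prod {q : QuasiIdentity L} (hA : Satisfies A q) (hB : Satisfies B q) :
    Satisfies (A.prod B) q := fun _ ha =>
  .prod (hA _ fun e he => (ha e he).map _) (hB _ fun e he => (ha e he).map _)

theorem IsQuasivariety.prod_mem {Q : Set (Alg.{u, v, w} L)} (hQ : IsQuasivariety Q)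
    (hA : A ∈ Q) (hB : B ∈ Q) : A.prod B ∈ Q := by
  obtain ⟨T, rfl⟩ := hQ
  exact fun q hq => (hA q hq).prod (hB q hq)

end Preservation

/-! ### Quotients and `Q`-congruences -/

section Quotients

variable {L : FirstOrder.Language.{u, v}} [L.IsAlgebraic] {A B : Alg.{u, v, w} L}
  {Q : Set (Alg.{u, v, w} L)}

/-- The canonical projection onto a quotient. -/
def quotMk (θ : Congruence A) : A →[L] A.quot θ :=
  homOfMapFun (B := A.quot θ) (Quotient.mk θ.toSetoid) fun g x =>
    (@funMap_quotient_mk' L A θ.toSetoid θ.prestructure _ g x).symm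

theorem quotMk_surjective (θ : Congruence A) : Function.Surjective (quotMk θ) :=
  Quotient.mk_surjective

theorem quotMk_eq_iff {θ : Congruence A} {a b : A} : quotMk θ a = quotMk θ b ↔ θ.r a b :=
  Quotient.eq

theorem eqHolds_quotMk_iff {X : Type x} {θ : Congruence A} {a : X → A}
    {e : L.Term X × L.Term X} :
    EqHolds (A.quot θ) (quotMk θ ∘ a) e ↔ θ.r (e.1.realize a) (e.2.realize a) := by
  unfold EqHolds
  rw [HomClass.realize_term, HomClass.realize_term, quotMk_eq_iff]

/-- Assignments lift along the surjection onto the quotient. Being a `Q`-congruence thus becomes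
closure under Horn clauses, a form suited to intersections and unions of chains. -/
theorem satisfies_quot_iff {θ : Congruence A} {q : QuasiIdentity L} :
    Satisfies (A.quot θ) q ↔ ∀ a : Fin q.numVars → A,
      (∀ e ∈ q.premise, θ.r (e.1.realize a) (e.2.realize a)) →
        θ.r (q.conclusion.1.realize a) (q.conclusion.2.realize a) := by
  unfold Satisfies
  rw [(quotMk_surjective θ).comp_left.forall]
  simp only [eqHolds_quotMk_iff]

/-- Homomorphisms that identify congruent elements factor through the quotient. -/
def quotLift (θ : Congruence A) (f : A →[L] B) (h : ∀ a b, θ.r a b → f a = f b) :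
    A.quot θ →[L] B :=
  homOfMapFun (A := A.quot θ) (Quotient.lift f h) fun g x => by
    obtain ⟨y, rfl⟩ := (quotMk_surjective θ).comp_left x
    rw [← HomClass.map_fun (quotMk θ) g y]
    exact HomClass.map_fun f g y

/-- The inverse image of a congruence under a homomorphism. -/
def Congruence.comap (f : A →[L] B) (θ : Congruence B) : Congruence A where
  r a b := θ.r (f a) (f b)
  iseqv := ⟨fun _ => θ.iseqv.refl _, θ.iseqv.symm, θ.iseqv.trans⟩
  compat g y z h := by
    rw [HomClass.map_fun, HomClass.map_fun]
    exact θ.compat g _ _ h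

/-- The quotient by the inverse image embeds into `B.quot θ`. -/
theorem IsQuasivariety.comap_mem_conQ (hQ : IsQuasivariety Q) (f : A →[L] B)
    {θ : Congruence B} (hθ : θ ∈ conQ Q B) : θ.comap f ∈ conQ Q A := by
  refine hQ.mem_of_injective (B := B.quot θ)
    (f := quotLift _ ((quotMk θ).comp f) fun a b h => quotMk_eq_iff.2 h) ?_ hθ
  intro x y h
  obtain ⟨a, rfl⟩ := quotMk_surjective _ x
  obtain ⟨b, rfl⟩ := quotMk_surjective _ y
  have hab : quotMk θ (f a) = quotMk θ (f b) := h
  exact quotMk_eq_iff.2 (show θ.r (f a) (f b) from quotMk_eq_iff.1 hab)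

theorem IsQuasivariety.eq_mem_conQ (hQ : IsQuasivariety Q) (hA : A ∈ Q) :
    Congruence.eq A ∈ conQ Q A := by
  refine hQ.mem_of_injective (B := A)
    (f := quotLift (Congruence.eq A) (.id L A) fun a b h => h) ?_ hA
  intro x y h
  obtain ⟨a, rfl⟩ := quotMk_surjective _ x
  obtain ⟨b, rfl⟩ := quotMk_surjective _ y
  exact quotMk_eq_iff.2 h

theorem IsQuasivariety.ker_mem_conQ (hQ : IsQuasivariety Q) (hB : B ∈ Q) (f : A →[L] B) :
    (Congruence.eq B).comap f ∈ conQ Q A :=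
  hQ.comap_mem_conQ f (hQ.eq_mem_conQ hB)

theorem IsQuasivariety.inter_mem_conQ (hQ : IsQuasivariety Q) {C : Set (Congruence A)}
    (hC : C ⊆ conQ Q A) : Congruence.inter C ∈ conQ Q A := by
  obtain ⟨T, rfl⟩ := hQ
  intro q hq
  rw [satisfies_quot_iff]
  exact fun a ha θ hθ => satisfies_quot_iff.1 (hC hθ q hq) a fun e he => ha e he θ hθ

theorem IsQuasivariety.leastCon_mem_conQ (hQ : IsQuasivariety Q) (H : Set (A × A)) :
    leastCon Q A H ∈ conQ Q A :=
  hQ.inter_mem_conQ fun _ h => h.1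

theorem subset_leastCon {H : Set (A × A)} {p : A × A} (hp : p ∈ H) :
    (leastCon Q A H).r p.1 p.2 :=
  fun _ hθ => hθ.2 p hp

/-- A homomorphism into a member of `Q` that identifies all pairs in `H` factors through the
quotient by the least `Q`-congruence containing `H`. -/
def leastConLift (hQ : IsQuasivariety Q) {H : Set (A × A)} (hB : B ∈ Q) (f : A →[L] B)
    (hf : ∀ p ∈ H, f p.1 = f p.2) : A.quot (leastCon Q A H) →[L] B :=
  quotLift _ f fun _ _ h => h ((Congruence.eq B).comap f) ⟨hQ.ker_mem_conQ hB f, hf⟩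

end Quotients

/-! ### Free algebras -/

section Free

variable {L : FirstOrder.Language.{u, v}} [L.IsAlgebraic] {A : Alg.{u, v, w} L}
  {Q : Set (Alg.{u, v, w} L)} {X : Type w} [Nonempty (L.Term X)]

/-- The evaluation homomorphism on the term algebra. -/
def evalHom (a : X → A) : termAlg L X →[L] A :=
  homOfMapFun (A := termAlg L X) (fun t => Term.realize (L := L) a t) fun _ _ => rfl

theorem IsQuasivariety.freeAlg_mem (hQ : IsQuasivariety Q) : freeAlg Q X ∈ Q := by
  -- Identities of `Q` are an intersection of kernels of evaluations into members of `Q`, and each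
  -- kernel is a `Q`-congruence.
  have h : freeCon Q X = Congruence.inter
      {θ | ∃ A ∈ Q, ∃ a : X → A, θ = (Congruence.eq A).comap (evalHom a)} := by
    unfold freeCon Congruence.inter
    congr 2
    funext s t
    refine propext ⟨?_, fun h A hA a => h _ ⟨A, hA, a, rfl⟩⟩
    rintro h _ ⟨A, hA, a, rfl⟩
    exact h A hA a
  have hmem : freeCon Q X ∈ conQ Q (termAlg L X) := by
    rw [h]
    apply hQ.inter_mem_conQ
    rintro _ ⟨A, hA, a, rfl⟩
    exact hQ.ker_mem_conQ hA _
  exact hmem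

/-- The homomorphism from the free algebra that extends an assignment of the variables. -/
def freeLift (hA : A ∈ Q) (a : X → A) : freeAlg Q X →[L] A :=
  quotLift _ (evalHom a) fun _ _ h => h A hA a

/-- The free generators. -/
def freeVar (Q : Set (Alg.{u, v, w} L)) (x : X) : freeAlg Q X :=
  quotMk (freeCon Q X) (Term.var x : L.Term X)

end Free

/-! ### Finite presentations -/

section Presentation

variable {L : FirstOrder.Language.{u, v}} [L.IsAlgebraic] {Q : Set (Alg.{u, v, w} L)}

theorem IsQuasivariety.mem_of_isFinitelyPresented (hQ : IsQuasivariety Q) {P : Alg.{u, v, w} L}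
    (hP : IsFinitelyPresented Q P) : P ∈ Q := by
  obtain ⟨k, _, H, -, ⟨e⟩⟩ := hP
  exact hQ.mem_of_injective (f := e.toHom) e.injective (hQ.leastCon_mem_conQ H)

/-- The premises of a quasi-identity have a universal model in `Q`: a finitely presented algebra
with an assignment such that every model in `Q` of the premises is a homomorphic image. -/
theorem IsQuasivariety.exists_presentation (hQ : IsQuasivariety Q) (q : QuasiIdentity L) :
    ∃ (P : Alg.{u, v, w} L) (g : Fin q.numVars → P), IsFinitelyPresented Q P ∧
      (∀ e ∈ q.premise, EqHolds P g e) ∧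
      ∀ A ∈ Q, ∀ a : Fin q.numVars → A, (∀ e ∈ q.premise, EqHolds A a e) →
        ∃ f : P →[L] A, f ∘ g = a := by
  -- The conclusion supplies a term even when there are no variables.
  have : Nonempty (L.Term (ULift.{w} (Fin q.numVars))) :=
    ⟨q.conclusion.1.relabel ULift.up⟩
  let F := freeAlg Q (ULift.{w} (Fin q.numVars))
  let v : Fin q.numVars → F := fun i => freeVar Q (ULift.up i)
  let H : Set (F × F) := (fun e => (e.1.realize v, e.2.realize v)) '' {e | e ∈ q.premise}
  refine ⟨F.quot (leastCon Q F H), quotMk _ ∘ v,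
    ⟨_, this, H, q.premise.finite_toSet.image _, ⟨.refl L _⟩⟩, ?_, ?_⟩
  · exact fun e he => eqHolds_quotMk_iff.2
      (subset_leastCon (p := (e.1.realize v, e.2.realize v)) ⟨e, he, rfl⟩)
  · intro A hA a ha
    have hv : freeLift hA (a ∘ ULift.down) ∘ v = a := rfl
    refine ⟨leastConLift hQ hA (freeLift hA (a ∘ ULift.down)) ?_, rfl⟩
    rintro _ ⟨e, he, rfl⟩
    have := ha e he
    unfold EqHolds at this
    rwa [← hv, HomClass.realize_term, HomClass.realize_term] at this

end Presentation

/-! ### Separation by subdirectly irreducible algebras -/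

section SubdirectlyIrreducible

variable {L : FirstOrder.Language.{u, v}} {A : Alg.{u, v, w} L}

theorem Congruence.exists_common_of_chain {C : Set (Congruence A)} (hne : C.Nonempty)
    (hC : IsChain (fun θ η => ∀ x y, θ.r x y → η.r x y) C) (l : List (A × A))
    (h : ∀ p ∈ l, ∃ θ ∈ C, θ.r p.1 p.2) : ∃ θ ∈ C, ∀ p ∈ l, θ.r p.1 p.2 := by
  have : Std.Refl fun θ η : Congruence A => ∀ x y, θ.r x y → η.r x y := ⟨fun _ _ _ h => h⟩
  induction l with
  | nil => exact hne.imp fun θ hθ => ⟨hθ, by simp⟩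
  | cons p l ih =>
    rw [List.forall_mem_cons] at h
    obtain ⟨⟨θ, hθ, hp⟩, hl⟩ := h
    obtain ⟨η, hη, hl⟩ := ih hl
    rcases hC.total hθ hη with hle | hle
    · exact ⟨η, hη, List.forall_mem_cons.2 ⟨hle _ _ hp, hl⟩⟩
    · exact ⟨θ, hθ, List.forall_mem_cons.2 ⟨hp, fun p hp => hle _ _ (hl p hp)⟩⟩

/-- The union of a nonempty chain of congruences. -/
def Congruence.sUnionOfChain (C : Set (Congruence A)) (hne : C.Nonempty)
    (hC : IsChain (fun θ η => ∀ x y, θ.r x y → η.r x y) C) : Congruence A where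
  r a b := ∃ θ ∈ C, θ.r a b
  iseqv := by
    refine ⟨fun a => ?_, ?_, ?_⟩
    · obtain ⟨θ, hθ⟩ := hne
      exact ⟨θ, hθ, θ.iseqv.refl a⟩
    · rintro a b ⟨θ, hθ, h⟩
      exact ⟨θ, hθ, θ.iseqv.symm h⟩
    · rintro a b c ⟨θ, hθ, h⟩ ⟨η, hη, h'⟩
      have : Std.Refl fun θ η : Congruence A => ∀ x y, θ.r x y → η.r x y := ⟨fun _ _ _ h => h⟩
      rcases hC.total hθ hη with hle | hle
      · exact ⟨η, hη, η.iseqv.trans (hle _ _ h) h'⟩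
      · exact ⟨θ, hθ, θ.iseqv.trans h (hle _ _ h')⟩
  compat {n} f y z h := by
    obtain ⟨θ, hθ, h⟩ := exists_common_of_chain hne hC
      (List.ofFn fun i => (y i, z i)) (by simpa [List.mem_ofFn] using h)
    exact ⟨θ, hθ, θ.compat f y z (by simpa [List.mem_ofFn] using h)⟩

variable [L.IsAlgebraic] {Q : Set (Alg.{u, v, w} L)}

theorem IsQuasivariety.sUnionOfChain_mem_conQ (hQ : IsQuasivariety Q) {C : Set (Congruence A)}
    (hne : C.Nonempty) (hC : IsChain (fun θ η => ∀ x y, θ.r x y → η.r x y) C)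
    (hCQ : C ⊆ conQ Q A) : Congruence.sUnionOfChain C hne hC ∈ conQ Q A := by
  obtain ⟨T, rfl⟩ := hQ
  intro q hq
  rw [satisfies_quot_iff]
  intro a ha
  obtain ⟨θ, hθ, h⟩ := Congruence.exists_common_of_chain hne hC
    (q.premise.map fun e => (e.1.realize a, e.2.realize a))
    (by rw [List.forall_mem_map]; exact ha)
  exact ⟨θ, hθ, satisfies_quot_iff.1 (hCQ hθ q hq) a (List.forall_mem_map.1 h)⟩

theorem IsQuasivariety.exists_maximal_conQ (hQ : IsQuasivariety Q) (hA : A ∈ Q) {s t : A}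
    (hst : s ≠ t) : ∃ θ ∈ conQ Q A, ¬ θ.r s t ∧
      ∀ η ∈ conQ Q A, (∀ x y, θ.r x y → η.r x y) → ¬ η.r s t → ∀ x y, η.r x y → θ.r x y := by
  let S := {θ : Congruence A // θ ∈ conQ Q A ∧ ¬ θ.r s t}
  obtain ⟨⟨θ, hθ, hn⟩, hmax⟩ := exists_maximal_of_chains_bounded
    (r := fun θ η : S => ∀ x y, θ.1.r x y → η.1.r x y) (fun C hC => by
      rcases C.eq_empty_or_nonempty with rfl | hne
      -- The empty chain is bounded by equality, a `Q`-congruence since `A ∈ Q`.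
      · exact ⟨⟨Congruence.eq A, hQ.eq_mem_conQ hA, hst⟩, by simp⟩
      have hC' : IsChain (fun θ η => ∀ x y, θ.r x y → η.r x y)
          (Subtype.val '' C : Set (Congruence A)) := by
        rintro _ ⟨θ, hθ, rfl⟩ _ ⟨η, hη, rfl⟩ hne
        exact hC hθ hη fun h => hne (congrArg _ h)
      refine ⟨⟨Congruence.sUnionOfChain _ (hne.image _) hC', ?_, ?_⟩, ?_⟩
      · apply hQ.sUnionOfChain_mem_conQ
        rintro _ ⟨θ, -, rfl⟩
        exact θ.2.1
      · rintro ⟨_, ⟨θ, -, rfl⟩, h⟩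
        exact θ.2.2 h
      · exact fun θ hθ x y h => ⟨θ.1, ⟨θ, hθ, rfl⟩, h⟩)
    (fun h h' x y hxy => h' x y (h x y hxy))
  exact ⟨θ, hθ, hn, fun η hη hle hne => hmax ⟨η, hη, hne⟩ hle⟩

/-- Distinct elements of a member of `Q` are separated by a homomorphism onto a `Q`-subdirectly
irreducible algebra. -/
theorem IsQuasivariety.exists_isSubdirectlyIrreducible (hQ : IsQuasivariety Q) (hA : A ∈ Q)
    {s t : A} (hst : s ≠ t) :
    ∃ S : Alg.{u, v, w} L, IsSubdirectlyIrreducible Q S ∧ ∃ f : A →[L] S, f s ≠ f t := by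
  obtain ⟨θ, hθ, hn, hmax⟩ := hQ.exists_maximal_conQ hA hst
  have hne : quotMk θ s ≠ quotMk θ t := fun h => hn (quotMk_eq_iff.1 h)
  refine ⟨A.quot θ, ⟨hθ, ⟨_, _, hne⟩, fun C hC hCeq => ?_⟩, quotMk θ, hne⟩
  by_contra hnot
  -- It suffices that every `η ∈ C` identifies the two classes. Otherwise its inverse image in `A`
  -- contains `θ` and omits `(s, t)`, so by maximality it lies in `θ`, making `η` the equality
  -- relation.
  suffices (Congruence.inter C).r (quotMk θ s) (quotMk θ t) by
    rw [hCeq] at this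
    exact hne this
  intro η hη
  by_contra hηst
  refine hnot ?_
  have hle := hmax (η.comap (quotMk θ)) (hQ.comap_mem_conQ _ (hC hη))
    (fun x y h => by
      change η.r (quotMk θ x) (quotMk θ y)
      rw [quotMk_eq_iff.2 h]) hηst
  have : Congruence.eq (A.quot θ) = η := by
    unfold Congruence.eq
    cases η with | mk η' _ =>
    congr 1
    ext x y
    obtain ⟨a, rfl⟩ := quotMk_surjective θ x
    obtain ⟨b, rfl⟩ := quotMk_surjective θ y
    refine ⟨fun h => ?_, fun h => quotMk_eq_iff.2 (hle a b h)⟩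
    rw [show quotMk θ a = quotMk θ b from h]
  exact this ▸ hη

end SubdirectlyIrreducible

end QuasiVar

theorem theorem3p1 {L : FirstOrder.Language.{u, v}} [L.IsAlgebraic]
    (Q : Set (QuasiVar.Alg.{u, v, w} L)) (hQ : QuasiVar.IsQuasivariety Q) :
    List.TFAE [
      QuasiVar.IsASC Q,
      ∀ A ∈ Q, A.prod (QuasiVar.freeOmega Q) ∈ QuasiVar.generatedBy (QuasiVar.freeOmega Q),
      ∀ S : QuasiVar.Alg.{u, v, w} L, QuasiVar.IsSubdirectlyIrreducible Q S →
        S.prod (QuasiVar.freeOmega Q) ∈ QuasiVar.generatedBy (QuasiVar.freeOmega Q),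
      ∀ A ∈ Q, Nonempty (A →[L] QuasiVar.freeOmega Q) →
        A ∈ QuasiVar.generatedBy (QuasiVar.freeOmega Q),
      ∀ P : QuasiVar.Alg.{u, v, w} L, QuasiVar.IsFinitelyPresented Q P →
        Nonempty (P →[L] QuasiVar.freeOmega Q) →
        P ∈ QuasiVar.generatedBy (QuasiVar.freeOmega Q)] := by
  have hF : QuasiVar.freeOmega Q ∈ Q := hQ.freeAlg_mem
  tfae_have 1 → 2 := by
    intro h A hA q hq
    by_cases hs : QuasiVar.SatisfiesStar (QuasiVar.freeOmega Q) q
    · exact (hs.of_hom (QuasiVar.prodSnd A _)).satisfies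
    · exact h q ⟨hq, hs⟩ _ (hQ.prod_mem hA hF)
  tfae_have 2 → 3 := fun h S hS => h S hS.1
  tfae_have 3 → 2 := by
    intro h A hA q hq a ha
    have hsnd := hq _ fun e he => (ha e he).map (QuasiVar.prodSnd A _)
    refine .prod ?_ hsnd
    -- As `q` holds in `F`, only the first coordinate can fail; map it to a separating `S` and keep
    -- the second.
    by_contra hfst
    obtain ⟨S, hS, f, hf⟩ := hQ.exists_isSubdirectlyIrreducible hA hfst
    have key := (h S hS q hq
      (fun i => (f (QuasiVar.prodFst A _ (a i)), QuasiVar.prodSnd A _ (a i)))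
      fun e he => .prod (((ha e he).map (QuasiVar.prodFst A _)).map f)
        ((ha e he).map (QuasiVar.prodSnd A _))).map (QuasiVar.prodFst S _)
    refine hf ?_
    rw [← FirstOrder.Language.HomClass.realize_term, ← FirstOrder.Language.HomClass.realize_term]
    exact key
  tfae_have 2 → 4 := fun h A hA ⟨f⟩ q hq =>
    (h A hA q hq).of_injective (QuasiVar.prodGraph_injective f)
  tfae_have 4 → 5 := fun h P hP => h P (hQ.mem_of_isFinitelyPresented hP)
  tfae_have 5 → 1 := by
    rintro h q ⟨hq, hs⟩ A hA a ha
    obtain ⟨P, g, hP, hg, hlift⟩ := hQ.exists_presentation q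
    unfold QuasiVar.SatisfiesStar at hs
    push Not at hs
    obtain ⟨b, hb⟩ := hs
    obtain ⟨f, -⟩ := hlift _ hF b hb
    obtain ⟨f', rfl⟩ := hlift A hA a ha
    exact (h P hP ⟨f⟩ q hq g hg).map f'
  tfae_finish
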